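/- Consider the directed graph with node set $N=\{0,1\}$ and edge set $E=\{\alpha,\beta\}$, where both edges $\alpha$ and $\beta$ go from node $0$ to node $1$. A CFSM protocol $\mathbf P$ with this communication graph consists of finite disjoint message alphabets $M_\alpha, M_\beta$ and two finite state machines $F_0,F_1$. The machine $F_j$ has a finite state set $K_j$, an initial state $h_j\in K_j$, and a set of transitions $T_j\subseteq K_j\times\Sigma_j\times K_j$, where $\Sigma_0=\{-b : b\in M_\alpha\cup M_\beta\}$ (sending) and $\Sigma_1=\{+b : b\in M_\alpha\cup M_\beta\}$ (receiving). A composite state is a pair $S=(p_0,p_1)\in K_0\times K_1$, a channel content is a pair $C=(x_\alpha,x_\beta)\in M_\alpha^*\times M_\beta^*$, and a global state is a pair $(S,C)$. One step of the protocol is either a transition $(p_0,-b,q_0)\in T_0$ with $b\in M_\xi$, which changes $p_0$ to $q_0$ and appends $b$ at the end of $x_\xi$, or a transition $(p_1,+b,q_1)\in T_1$ with $b\in M_\xi$, which is possible when $x_\xi$ begins with $b$, changes $p_1$ to $q_1$ and removes this first symbol $b$ from $x_\xi$. A global state is reachable if finitely many (possibly zero) steps lead to it from $((h_0,h_1),(\lambda,\lambda))$,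 where $\lambda$ is the empty string. A composite state $S$ is stable if $(S,(\lambda,\lambda))$ is reachable. The protocol has the rational channel property if for every composite state $S$ the relation $\mathbf L(S)=\{C : (S,C)\text{ is reachable}\}\subseteq M_\alpha^*\times M_\beta^*$ is rational, that is, belongs to the smallest family of subsets of the monoid $M_\alpha^*\times M_\beta^*$ that contains the empty set and all singletons and is closed under finite unions, products and the star operation (generated submonoid). **Theorem.** The problem "Is a given composite state stable?" is algorithmically decidable for the CFSM protocols with the rational channel property and this communication graph. That is, there is a single algorithm (partial recursive function) which, given (a finite description of) any such protocol $\mathbf P$ with the rational channel property and any composite state $S$ of $\mathbf P$, halts and correctly answers whether $S$ is stable. -/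

import Mathlib

universe u v

/-- A directed graph with node set `N` and edge set `E`: every edge `ξ` has a tail `-ξ` and a
head `+ξ`.  Parallel edges and loops are allowed. -/
structure CommGraph (N E : Type*) where
  tail : E → N
  head : E → N

/-- The letters of the alphabet `Σ_j` of the machine at node `j`: a letter `+b` for every message
`b` of a channel `ξ` with head `j`, and a letter `-b` for every message `b` of a channel `ξ`
with tail `j`.  As a letter carries its channel, the alphabets `M_ξ` count as pairwise disjoint. -/
inductive Letter {N E : Type} (G : CommGraph N E) (Msg : E → Type u) (j : N) : Type u
  | recv (ξ : E) (h : G.head ξ = j) (b : Msg ξ) : Letter G Msg j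
  | send (ξ : E) (h : G.tail ξ = j) (b : Msg ξ) : Letter G Msg j

/-- A protocol of communicating finite state machines with communication graph `G`. -/
structure CFSMProtocol {N E : Type} (G : CommGraph N E) where
  /-- the messages `M_ξ` of the channel `ξ` -/
  Msg : E → Type u
  /-- the states `K_j` of the machine `F_j` -/
  State : N → Type v
  finite_msg : ∀ ξ, Finite (Msg ξ)
  finite_state : ∀ j, Finite (State j)
  /-- the initial state `h_j` -/
  home : ∀ j, State j
  /-- the transitions `T_j ⊆ K_j × Σ_j × K_j` -/
  trans : ∀ j, Set (State j × Letter G Msg j × State j)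

namespace CFSMProtocol

variable {N E : Type} {G : CommGraph N E} (P : CFSMProtocol.{u, v} G)

/-- A composite state: one state for every machine. -/
abbrev CompositeState : Type v := ∀ j, P.State j

/-- A channel content: one string for every channel.  These form a product of free monoids;
its unit `1` is the content in which all channels are empty. -/
abbrev ChannelContent : Type u := ∀ ξ, FreeMonoid (P.Msg ξ)

/-- A global state. -/
abbrev GlobalState : Type (max u v) := P.CompositeState × P.ChannelContent

/-- The one-step relation between global states; channels are perfect unbounded FIFO queues. -/
inductive Step : P.GlobalState → P.GlobalState → Prop
  /-- `+b`: the machine at the head of `ξ` removes `b` from the front of the channel `ξ`. -/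
  | recv (S S' : P.CompositeState) (C C' : P.ChannelContent) (j : N) (ξ : E) (h : G.head ξ = j)
      (b : P.Msg ξ)
      (local_step : (S j, Letter.recv ξ h b, S' j) ∈ P.trans j)
      (other_states : ∀ i, i ≠ j → S' i = S i)
      (channel : C ξ = FreeMonoid.of b * C' ξ)
      (other_channels : ∀ η, η ≠ ξ → C' η = C η) : Step (S, C) (S', C')
  /-- `-b`: the machine at the tail of `ξ` appends `b` at the end of the channel `ξ`. -/
  | send (S S' : P.CompositeState) (C C' : P.ChannelContent) (j : N) (ξ : E) (h : G.tail ξ = j)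
      (b : P.Msg ξ)
      (local_step : (S j, Letter.send ξ h b, S' j) ∈ P.trans j)
      (other_states : ∀ i, i ≠ j → S' i = S i)
      (channel : C' ξ = C ξ * FreeMonoid.of b)
      (other_channels : ∀ η, η ≠ ξ → C' η = C η) : Step (S, C) (S', C')

/-- A global state is reachable if finitely many steps lead to it from the initial global state,
in which every machine is in its home state and all channels are empty. -/
def Reachable (X : P.GlobalState) : Prop :=
  Relation.ReflTransGen P.Step (P.home, 1) X

/-- A composite state is stable if it is reachable with empty channels. -/
def Stable (S : P.CompositeState) : Prop :=
  P.Reachable (S, 1)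

/-- `L(S)`: the channel contents that occur together with the composite state `S`. -/
def channelRel (S : P.CompositeState) : Set P.ChannelContent :=
  {C | P.Reachable (S, C)}

end CFSMProtocol

open scoped Pointwise in
/-- The rational subsets of a monoid: the smallest family that contains the empty set and the
singletons and is closed under union, product and star (generated submonoid).  A rational
relation is a rational subset of a product of free monoids. -/
inductive IsRational {M : Type*} [Monoid M] : Set M → Prop
  | empty : IsRational ∅
  | singleton (x : M) : IsRational {x}
  | union {A B : Set M} : IsRational A → IsRational B → IsRational (A ∪ B)
  | mul {A B : Set M} : IsRational A → IsRational B → IsRational (A * B)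
  | star {A : Set M} : IsRational A → IsRational (Submonoid.closure A : Set M)

/-- The rational channel property: every relation `L(S)` is rational. -/
def CFSMProtocol.RationalChannelProperty {N E : Type} {G : CommGraph N E}
    (P : CFSMProtocol.{u, v} G) : Prop :=
  ∀ S : P.CompositeState, IsRational (P.channelRel S)

/-- The graph with nodes `0`, `1` and two parallel edges from `0` to `1`. -/
def parallelGraph : CommGraph (Fin 2) (Fin 2) where
  tail := fun _ => 0
  head := fun _ => 1

/-- The finite data handed to an algorithm as its input, describing a protocol whose graph has `n`
nodes and `m` edges.  States and messages are numbered from `0` on.  A list entry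
`(p, (s, ξ, b), q)` stands for the transition from `p` to `q` that receives (`s = true`) or
sends (`s = false`) the message `b` on the channel `ξ`. -/
structure ProtocolCode (n m : ℕ) where
  numStates : Fin n → ℕ
  numMsgs : Fin m → ℕ
  home : Fin n → ℕ
  trans : Fin n → List (ℕ × (Bool × Fin m × ℕ) × ℕ)

/-- A code as a tuple; this fixes which functions of codes count as computable. -/
def ProtocolCode.equivTuple (n m : ℕ) :
    ProtocolCode n m ≃ (Fin n → ℕ) × (Fin m → ℕ) × (Fin n → ℕ) ×
      (Fin n → List (ℕ × (Bool × Fin m × ℕ) × ℕ)) where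
  toFun c := (c.numStates, c.numMsgs, c.home, c.trans)
  invFun t := ⟨t.1, t.2.1, t.2.2.1, t.2.2.2⟩
  left_inv _ := rfl
  right_inv _ := rfl

instance ProtocolCode.instPrimcodable (n m : ℕ) : Primcodable (ProtocolCode n m) :=
  Primcodable.ofEquiv _ (ProtocolCode.equivTuple n m)

/-- The code of a letter, for a given numbering of the messages. -/
def Letter.code {n m : ℕ} {G : CommGraph (Fin n) (Fin m)} {Msg : Fin m → Type u}
    (num : ∀ ξ, Msg ξ → ℕ) {j : Fin n} : Letter G Msg j → Bool × Fin m × ℕ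
  | .recv ξ _ b => (true, ξ, num ξ b)
  | .send ξ _ b => (false, ξ, num ξ b)

/-- A numbering of the states and messages of the protocol `P` under which `c` is the code
of `P`. -/
structure CFSMProtocol.Numbering {n m : ℕ} {G : CommGraph (Fin n) (Fin m)}
    (P : CFSMProtocol.{u, v} G) (c : ProtocolCode n m) where
  state : ∀ j, P.State j ≃ Fin (c.numStates j)
  msg : ∀ ξ, P.Msg ξ ≃ Fin (c.numMsgs ξ)
  home_eq : ∀ j, (state j (P.home j) : ℕ) = c.home j
  /-- the list `c.trans j` enumerates the codes of the transitions in `T_j` -/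
  mem_trans_iff : ∀ j t, t ∈ c.trans j ↔ ∃ p l q, (p, l, q) ∈ P.trans j ∧
    t = ((state j p : ℕ), Letter.code (fun ξ b => (msg ξ b : ℕ)) l, (state j q : ℕ))

/-- The code of a composite state. -/
def CFSMProtocol.Numbering.code {n m : ℕ} {G : CommGraph (Fin n) (Fin m)}
    {P : CFSMProtocol.{u, v} G} {c : ProtocolCode n m} (ν : P.Numbering c)
    (S : P.CompositeState) : Fin n → ℕ :=
  fun j => ν.state j (S j)

/-! Both stability and instability have finite witnesses that can be checked primitive recursively,
so a search through all candidates of both kinds decides the question.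

Stability: no channel leads back to node 0, so the sender may complete its whole path before the
receiver starts. A state is therefore stable exactly if a sender path and a receiver path carry
equal words on both channels (`exists_isStabilityWitness_iff`).

Instability: two such paths can be interleaved so that at most one channel is nonempty, apart from
messages received as soon as they are sent. If the receiver next needs a message from the currently
empty channel, the sender either prolongs the nonempty channel or sends just the required message.
If the receiver needs one from the axis channel and that is empty, both channels are empty and their
roles are exchanged. Hence only contents lying on one of the two axes matter, and any family of such
contents that contains the initial one, is closed under these moves and avoids the target refutes
stability (`IsInstabilityCertificate.not_paths`).

Rationality makes a finite family of this kind exist. The section of a rational relation along an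
axis is a regular language (`IsRational.isRegular_axisSection`), and finitely many regular languages
are saturated by one two-sided congruence of finite index (`Language.exists_congruence_numbering`).
Sends multiply classes on the right and receives cancel on the left, so the classes of the truly
reachable contents form a certificate. -/

/-! ### Regular languages: products, stars and finite congruences -/

namespace Language

variable {α : Type*}

/-- The left quotients of `L` by those suffixes of `w` that remain after a prefix in `K`. -/
def splitQuotients (K L : Language α) (w : List α) : Set (Language α) :=
  {Q | ∃ x y, w = x ++ y ∧ x ∈ K ∧ Q = L.leftQuotient y}

/-- The union of a set of languages. -/
def unionOf (S : Set (Language α)) : Language α :=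
  {y | ∃ Q ∈ S, y ∈ Q}

theorem splitQuotients_subset (K L : Language α) (w : List α) :
    splitQuotients K L w ⊆ Set.range L.leftQuotient := by
  rintro Q ⟨x, y, -, -, rfl⟩
  exact ⟨y, rfl⟩

/-- The end of `w` falls either inside the factor from `K` or inside the factor from `L`. Both
summands depend on finite data when `K` and `L` have finitely many quotients, which gives regularity
of the product by Myhill–Nerode. -/
theorem leftQuotient_mul (K L : Language α) (w : List α) :
    (K * L).leftQuotient w =
      K.leftQuotient w * L + unionOf (splitQuotients K L w) := by
  ext y
  simp only [mem_leftQuotient, mem_add, mem_mul]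
  constructor
  · rintro ⟨a, ha, b, hb, hab⟩
    rcases List.append_eq_append_iff.1 hab with ⟨z, rfl, rfl⟩ | ⟨z, rfl, rfl⟩
    · exact Or.inr ⟨_, ⟨a, z, rfl, ha, rfl⟩, hb⟩
    · exact Or.inl ⟨z, ha, b, hb, rfl⟩
  · rintro (⟨a, ha, b, hb, rfl⟩ | ⟨_, ⟨x, z, rfl, hx, rfl⟩, hy⟩)
    · exact ⟨w ++ a, ha, b, hb, by simp⟩
    · exact ⟨x, hx, z ++ y, hy, by simp⟩

theorem IsRegular.mul_of_isRegular {K L : Language α} (hK : K.IsRegular) (hL : L.IsRegular) :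
    (K * L).IsRegular := by
  apply IsRegular.of_finite_range_leftQuotient
  have h1 := hK.finite_range_leftQuotient
  have h2 := hL.finite_range_leftQuotient.powerset
  refine ((h1.prod h2).image
    fun q : Language α × Set (Language α) => q.1 * L + unionOf q.2).subset ?_
  rintro _ ⟨w, rfl⟩
  exact ⟨(K.leftQuotient w, splitQuotients K L w), ⟨⟨w, rfl⟩, splitQuotients_subset K L w⟩,
    (leftQuotient_mul K L w).symm⟩

/-- Locates the factor `v ++ z` in which the end of `w` lies. This is the star analogue of splitting
a product. -/
theorem exists_split_of_flatten_eq {L : Language α} {y : List α} (S : List (List α)) :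
    ∀ w : List α, w ≠ [] → w ++ y = S.flatten → (∀ s ∈ S, s ∈ L) →
      ∃ u v z t, w = u ++ v ∧ u ∈ KStar.kstar L ∧ y = z ++ t ∧ v ++ z ∈ L ∧
        t ∈ KStar.kstar L := by
  induction S with
  | nil => intro w hw h; simp_all
  | cons s S ih =>
    intro w hw h hS
    simp only [List.mem_cons, forall_eq_or_imp] at hS
    have hrest : S.flatten ∈ KStar.kstar L := join_mem_kstar hS.2
    rw [List.flatten_cons] at h
    rcases List.append_eq_append_iff.1 h with ⟨z, rfl, rfl⟩ | ⟨z, rfl, hz⟩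
    · exact ⟨[], w, z, S.flatten, rfl, nil_mem_kstar L, rfl, hS.1, hrest⟩
    -- If `w` ends exactly between two factors, the one before the boundary is chosen, since the
    -- induction needs a nonempty remainder.
    · by_cases hz0 : z = []
      · subst hz0
        exact ⟨[], s, [], S.flatten, by simp, nil_mem_kstar L, by simpa using hz.symm,
          by simpa using hS.1, hrest⟩
      · obtain ⟨u, v, z', t, rfl, hu, rfl, hv, ht⟩ := ih z hz0 hz.symm hS.2
        refine ⟨s ++ u, v, z', t, by simp, ?_, rfl, hv, ht⟩
        rw [← one_add_self_mul_kstar_eq_kstar L]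
        exact Or.inr ⟨s, hS.1, u, hu, rfl⟩

theorem leftQuotient_kstar (L : Language α) {w : List α} (hw : w ≠ []) :
    (KStar.kstar L).leftQuotient w =
      {y | ∃ Q ∈ splitQuotients (KStar.kstar L) L w, y ∈ Q * KStar.kstar L} := by
  ext y
  constructor
  · intro h
    obtain ⟨S, hS, hSL⟩ := h
    obtain ⟨u, v, z, t, rfl, hu, rfl, hv, ht⟩ := exists_split_of_flatten_eq S w hw hS hSL
    exact ⟨_, ⟨u, v, rfl, hu, rfl⟩, z, hv, t, ht, rfl⟩
  · rintro ⟨_, ⟨u, v, rfl, hu, rfl⟩, z, hz, t, ht, rfl⟩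
    have h : u ++ ((v ++ z) ++ t) ∈ KStar.kstar L * (L * KStar.kstar L) :=
      ⟨u, hu, _, ⟨_, hz, t, ht, rfl⟩, rfl⟩
    have h' := (mul_le_mul_right (mul_kstar_le_kstar (a := L)) (KStar.kstar L)) h
    rw [kstar_mul_kstar] at h'
    rw [mem_leftQuotient, List.append_assoc, ← List.append_assoc v]
    exact h'

theorem IsRegular.kstar_of_isRegular {L : Language α} (hL : L.IsRegular) :
    (KStar.kstar L).IsRegular := by
  apply IsRegular.of_finite_range_leftQuotient
  have h2 := hL.finite_range_leftQuotient.powerset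
  -- The quotient by the empty word is the star itself; it is inserted separately because the
  -- formula holds only for nonempty words.
  refine ((h2.image fun q : Set (Language α) =>
    ({y | ∃ Q ∈ q, y ∈ Q * KStar.kstar L} : Language α)).insert (KStar.kstar L)).subset ?_
  rintro _ ⟨w, rfl⟩
  by_cases hw : w = []
  · subst hw
    exact Or.inl rfl
  · exact Or.inr ⟨_, splitQuotients_subset (KStar.kstar L) L w, (leftQuotient_kstar L hw).symm⟩

theorem isRegular_empty : (0 : Language α).IsRegular := by
  apply IsRegular.of_finite_range_leftQuotient
  refine (Set.finite_singleton (0 : Language α)).subset ?_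
  rintro _ ⟨w, rfl⟩
  rfl

theorem isRegular_singleton (x : List α) : ({x} : Language α).IsRegular := by
  apply IsRegular.of_finite_range_leftQuotient
  refine ((List.finite_toSet x.tails).image
    fun z => ({z} : Language α)).insert (0 : Language α) |>.subset ?_
  rintro _ ⟨w, rfl⟩
  by_cases hw : w <+: x
  · obtain ⟨z, rfl⟩ := hw
    refine Or.inr ⟨z, by simp, ?_⟩
    ext y
    change y = z ↔ w ++ y = w ++ z
    simp
  · refine Or.inl ?_
    ext y
    change w ++ y = x ↔ False
    simp only [iff_false]
    rintro rfl
    exact hw (List.prefix_append _ _)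

/-- A finite family of regular languages is saturated by a two-sided congruence of finite index;
`ψ` numbers its classes. -/
theorem exists_congruence_numbering {ι : Type*} [Finite ι] (U : ι → Language α)
    (hU : ∀ i, (U i).IsRegular) :
    ∃ (k : ℕ) (ψ : List α → ℕ), (∀ m, m < k ↔ ∃ x, ψ x = m) ∧
      ∀ x y, ψ x = ψ y → (∀ a, ψ (a :: x) = ψ (a :: y)) ∧
        (∀ a, ψ (x ++ [a]) = ψ (y ++ [a])) ∧ ∀ i, x ∈ U i ↔ y ∈ U i := by
  choose σ hσ M hM using hU
  -- The congruence is equality in the transition monoid of all the automata together. It is finite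
  -- even over an infinite alphabet.
  let φ : List α → ∀ i, σ i → σ i := fun x i s => (M i).evalFrom s x
  have : Finite (Set.range φ) := Subtype.finite
  obtain ⟨k, ⟨e⟩⟩ := Finite.exists_equiv_fin (Set.range φ)
  have key : ∀ x y, ((e ⟨φ x, x, rfl⟩ : Fin k) : ℕ) = (e ⟨φ y, y, rfl⟩ : Fin k) ↔ φ x = φ y := by
    intro x y
    rw [← Fin.ext_iff, e.apply_eq_iff_eq]
    exact Subtype.ext_iff
  refine ⟨k, fun x => e ⟨φ x, x, rfl⟩, fun m => ⟨fun hm => ?_, ?_⟩, fun x y h => ?_⟩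
  · obtain ⟨x, hx⟩ := (e.symm ⟨m, hm⟩).2
    refine ⟨x, ?_⟩
    have : (⟨φ x, x, rfl⟩ : Set.range φ) = e.symm ⟨m, hm⟩ := Subtype.ext hx
    simp [this]
  · rintro ⟨x, rfl⟩
    exact Fin.is_lt _
  · have h := (key x y).1 h
    have hs : ∀ i s, (M i).evalFrom s x = (M i).evalFrom s y :=
      fun i s => congrFun (congrFun h i) s
    refine ⟨fun a => (key _ _).2 ?_, fun a => (key _ _).2 ?_, fun i => ?_⟩
    · funext i s
      exact hs i _
    · funext i s
      simp [φ, DFA.evalFrom_of_append, hs]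
    · rw [← hM i, DFA.mem_accepts, DFA.mem_accepts]
      unfold DFA.eval
      rw [hs]

end Language

/-! ### Sections of rational relations along one channel -/

/-- The codes of the words `x` such that `A` contains the tuple with `x` on the channel `ξ` and
the empty word elsewhere. -/
def axisSection {E : Type} {Msg : E → Type u} (num : ∀ ξ, Msg ξ → ℕ) (ξ : E)
    (A : Set (∀ ξ, FreeMonoid (Msg ξ))) : Language ℕ :=
  {x | ∃ C ∈ A, (∀ η, η ≠ ξ → C η = 1) ∧ (C ξ).toList.map (num ξ) = x}

section axisSection

variable {E : Type} {Msg : E → Type u} (num : ∀ ξ, Msg ξ → ℕ) (ξ : E)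

-- In a free monoid a product is empty only if both factors are, so a product on the axis has both
-- factors on the axis.
open scoped Pointwise in
theorem axisSection_mul (A B : Set (∀ ξ, FreeMonoid (Msg ξ))) :
    axisSection num ξ (A * B) = axisSection num ξ A * axisSection num ξ B := by
  ext x
  constructor
  · rintro ⟨_, ⟨C, hC, D, hD, rfl⟩, h1, rfl⟩
    have h (η) (hη : η ≠ ξ) : C η = 1 ∧ D η = 1 := by
      exact List.append_eq_nil_iff.1 (h1 η hη)
    exact ⟨_, ⟨C, hC, fun η hη => (h η hη).1, rfl⟩, _, ⟨D, hD, fun η hη => (h η hη).2, rfl⟩,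
      by simp⟩
  · rintro ⟨_, ⟨C, hC, h1, rfl⟩, _, ⟨D, hD, h2, rfl⟩, rfl⟩
    exact ⟨C * D, ⟨C, hC, D, hD, rfl⟩, fun η hη => by simp [h1 η hη, h2 η hη], by simp⟩

theorem axisSection_closure (A : Set (∀ ξ, FreeMonoid (Msg ξ))) :
    axisSection num ξ (Submonoid.closure A : Set (∀ ξ, FreeMonoid (Msg ξ))) =
      KStar.kstar (axisSection num ξ A) := by
  ext x
  constructor
  · rintro ⟨C, hC, h1, rfl⟩
    induction hC using Submonoid.closure_induction with
    | mem C hC =>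
      have h : (C ξ).toList.map (num ξ) ∈ axisSection num ξ A := ⟨C, hC, h1, rfl⟩
      exact (le_kstar : axisSection num ξ A ≤ _) h
    | one => simpa using Language.nil_mem_kstar _
    | mul C D _ _ ihC ihD =>
      have h (η) (hη : η ≠ ξ) : C η = 1 ∧ D η = 1 := by
        exact List.append_eq_nil_iff.1 (h1 η hη)
      have hm : (C ξ).toList.map (num ξ) ++ (D ξ).toList.map (num ξ) ∈
          KStar.kstar (axisSection num ξ A) * KStar.kstar (axisSection num ξ A) :=
        ⟨_, ihC fun η hη => (h η hη).1, _, ihD fun η hη => (h η hη).2, rfl⟩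
      rw [kstar_mul_kstar] at hm
      simpa using hm
  · rintro ⟨S, rfl, hS⟩
    induction S with
    | nil => exact ⟨1, Submonoid.one_mem _, fun _ _ => rfl, by simp⟩
    | cons s S ih =>
      simp only [List.mem_cons, forall_eq_or_imp] at hS
      obtain ⟨C, hC, h1, rfl⟩ := hS.1
      obtain ⟨D, hD, h2, h3⟩ := ih hS.2
      exact ⟨C * D, Submonoid.mul_mem _ (Submonoid.subset_closure hC) hD,
        fun η hη => by simp [h1 η hη, h2 η hη], by simp [h3]⟩

/-- Taking the section commutes with union, product and star, so a rational expression for the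
relation turns into one for the section. -/
theorem IsRational.isRegular_axisSection {A : Set (∀ ξ, FreeMonoid (Msg ξ))}
    (hA : IsRational A) : (axisSection num ξ A).IsRegular := by
  induction hA with
  | empty =>
    convert Language.isRegular_empty (α := ℕ)
    ext x
    simp [axisSection]
    exact Language.notMem_zero x
  | singleton C =>
    by_cases h : ∀ η, η ≠ ξ → C η = 1
    · convert Language.isRegular_singleton ((C ξ).toList.map (num ξ))
      ext x
      constructor
      · rintro ⟨_, rfl, _, rfl⟩; rfl
      · rintro rfl; exact ⟨C, rfl, h, rfl⟩
    · convert Language.isRegular_empty (α := ℕ)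
      ext x
      constructor
      · rintro ⟨_, rfl, h', _⟩; exact absurd h' h
      · rintro ⟨⟩
  | @union A B _ _ ihA ihB =>
    convert ihA.add ihB
    ext x
    constructor
    · rintro ⟨C, hC | hC, h⟩
      · exact Or.inl ⟨C, hC, h⟩
      · exact Or.inr ⟨C, hC, h⟩
    · rintro (⟨C, hC, h⟩ | ⟨C, hC, h⟩)
      · exact ⟨C, Or.inl hC, h⟩
      · exact ⟨C, Or.inr hC, h⟩
  | mul _ _ ihA ihB =>
    rw [axisSection_mul]
    exact ihA.mul_of_isRegular ihB
  | star _ ih =>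
    rw [axisSection_closure]
    exact ih.kstar_of_isRegular

end axisSection

/-! ### Finite witnesses of stability and of instability -/

/-- A list entry of a `ProtocolCode 2 2`. -/
abbrev CodedTransition := ℕ × (Bool × Fin 2 × ℕ) × ℕ

namespace CodedTransition

/-- The source state. -/
abbrev src (t : CodedTransition) : ℕ := t.1
/-- The channel of the letter. -/
abbrev chan (t : CodedTransition) : Fin 2 := t.2.1.2.1
/-- The message of the letter. -/
abbrev msg (t : CodedTransition) : ℕ := t.2.1.2.2
/-- The target state. -/
abbrev dst (t : CodedTransition) : ℕ := t.2.2

end CodedTransition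

/-- The messages of channel `ξ` along a list of transitions. -/
def channelWord (ξ : Fin 2) (ts : List CodedTransition) : List ℕ :=
  ts.filterMap fun t => if t.chan = ξ then some t.msg else none

/-- The list `ts` of transitions in `T` is a path from `p` to `q`. -/
def IsPath (T : List CodedTransition) (p : ℕ) (ts : List CodedTransition) (q : ℕ) : Prop :=
  (∀ t ∈ ts, t ∈ T) ∧ p :: ts.map CodedTransition.dst = ts.map CodedTransition.src ++ [q]

/-- Two paths, one of the sender and one of the receiver, with the same words on both channels:
a witness of stability. -/
def IsStabilityWitness (c : ProtocolCode 2 2) (s : Fin 2 → ℕ)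
    (w : List CodedTransition × List CodedTransition) : Prop :=
  IsPath (c.trans 0) (c.home 0) w.1 (s 0) ∧ IsPath (c.trans 1) (c.home 1) w.2 (s 1) ∧
    ∀ ξ, channelWord ξ w.1 = channelWord ξ w.2

/-- Finite data describing classes of words over the messages of one channel, and a set of
triples (sender state, receiver state, class). -/
abbrev ClassTable := ℕ × ℕ × List ℕ × List ℕ × List (ℕ × ℕ × ℕ)

namespace ClassTable

variable (D : ClassTable)

/-- The number of classes. -/
abbrev size : ℕ := D.1
/-- The class of the empty word. -/
abbrev start : ℕ := D.2.1
/-- The class of `x ++ [a]` for `x` in the class `m`. -/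
abbrev right (a m : ℕ) : ℕ := D.2.2.1.getD (Nat.pair a m) 0
/-- The class of `a :: x` for `x` in the class `m`. -/
abbrev left (a m : ℕ) : ℕ := D.2.2.2.1.getD (Nat.pair a m) 0
/-- The triples (sender state, receiver state, class). -/
abbrev triples : List (ℕ × ℕ × ℕ) := D.2.2.2.2

/-- The table describes classes of a two-sided congruence, as far as the letters of the sender
(transitions `T₀`) and of the receiver (transitions `T₁`) are concerned. -/
def IsCoherent (T₀ T₁ : List CodedTransition) : Prop :=
  D.start < D.size ∧
  (∀ t ∈ T₀, ∀ m < D.size, D.right t.msg m < D.size) ∧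
  (∀ t ∈ T₀, ∀ t' ∈ T₁, ∀ m < D.size,
    D.left t'.msg (D.right t.msg m) = D.right t.msg (D.left t'.msg m)) ∧
  ∀ t' ∈ T₁, D.left t'.msg D.start = D.right t'.msg D.start

/-- The triples are closed under the steps that keep the channel other than `ξ` empty, where a
message on the other channel is received as soon as it is sent. -/
def IsClosed (ξ : Fin 2) (T₀ T₁ : List CodedTransition) : Prop :=
  (∀ e ∈ D.triples, ∀ t ∈ T₀, e.1 = t.src → t.chan = ξ →
    (t.dst, e.2.1, D.right t.msg e.2.2) ∈ D.triples) ∧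
  (∀ e ∈ D.triples, ∀ t' ∈ T₁, e.2.1 = t'.src → t'.chan = ξ → ∀ m < D.size,
    D.left t'.msg m = e.2.2 → (e.1, t'.dst, m) ∈ D.triples) ∧
  ∀ e ∈ D.triples, ∀ t ∈ T₀, ∀ t' ∈ T₁, e.1 = t.src → e.2.1 = t'.src →
    t.chan = t'.chan → t.msg = t'.msg → t.chan ≠ ξ → (t.dst, t'.dst, e.2.2) ∈ D.triples

end ClassTable

/-- A certificate that the composite state with code `s` is not stable. -/
def IsInstabilityCertificate (c : ProtocolCode 2 2) (s : Fin 2 → ℕ) (D : Fin 2 → ClassTable) :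
    Prop :=
  ∀ ξ, (D ξ).IsCoherent (c.trans 0) (c.trans 1) ∧ (D ξ).IsClosed ξ (c.trans 0) (c.trans 1) ∧
    (c.home 0, c.home 1, (D ξ).start) ∈ (D ξ).triples ∧
    (∀ η, ∀ e ∈ (D ξ).triples, e.2.2 = (D ξ).start →
      (e.1, e.2.1, (D η).start) ∈ (D η).triples) ∧
    (s 0, s 1, (D ξ).start) ∉ (D ξ).triples

/-! ### Primitive recursive checking of the witnesses -/

namespace PrimrecPred

variable {α β : Type*} [Primcodable α] [Primcodable β]

theorem imp {p q : α → Prop} (hp : PrimrecPred p) (hq : PrimrecPred q) :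
    PrimrecPred fun a => p a → q a :=
  (hp.not.or hq).of_eq fun _ => (imp_iff_not_or).symm

theorem ball_list {p : α → β → Prop} {f : α → List β}
    (hp : PrimrecPred fun x : α × β => p x.1 x.2) (hf : Primrec f) :
    PrimrecPred fun a => ∀ b ∈ f a, p a b := by
  have h : PrimrecRel fun (b : β) (a : α) => p a b :=
    (hp.comp (Primrec.pair Primrec.snd Primrec.fst)).primrecRel
  exact h.forall_mem_list.comp hf Primrec.id

theorem ball_lt {p : α → ℕ → Prop} {f : α → ℕ}
    (hp : PrimrecPred fun x : α × ℕ => p x.1 x.2) (hf : Primrec f) :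
    PrimrecPred fun a => ∀ b < f a, p a b := by
  exact (ball_list hp (Primrec.list_range.comp hf)).of_eq fun a => by simp

theorem list_mem {f : α → β} {g : α → List β} (hf : Primrec f) (hg : Primrec g) :
    PrimrecPred fun a => f a ∈ g a := by
  classical
  have h : PrimrecRel fun (b b' : β) => b = b' := Primrec.eq
  exact (h.exists_mem_list.comp hg hf).of_eq fun a => by simp

theorem forall_fin_two {p : Fin 2 → α → Prop} (hp : ∀ i, PrimrecPred (p i)) :
    PrimrecPred fun a => ∀ i, p i a :=
  ((hp 0).and (hp 1)).of_eq fun a => (Fin.forall_fin_two (p := fun i => p i a)).symm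

theorem eq_comp {f g : α → β} (hf : Primrec f) (hg : Primrec g) :
    PrimrecPred fun a => f a = g a :=
  Primrec.eq.comp hf hg

end PrimrecPred

section Primrec

open Primrec

variable {α : Type*} [Primcodable α]

theorem Primrec.protocolCode_home (i : Fin 2) :
    Primrec fun c : ProtocolCode 2 2 => c.home i := by
  have h : Primrec (ProtocolCode.equivTuple 2 2) := Primrec.of_equiv
  exact fin_app.comp (fst.comp (snd.comp (snd.comp h))) (const i)

theorem Primrec.protocolCode_trans (i : Fin 2) :
    Primrec fun c : ProtocolCode 2 2 => c.trans i := by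
  have h : Primrec (ProtocolCode.equivTuple 2 2) := Primrec.of_equiv
  exact fin_app.comp (snd.comp (snd.comp (snd.comp h))) (const i)

theorem Primrec.transition_src {f : α → CodedTransition} (hf : Primrec f) :
    Primrec fun a => (f a).src := fst.comp hf

theorem Primrec.transition_dst {f : α → CodedTransition} (hf : Primrec f) :
    Primrec fun a => (f a).dst := snd.comp (snd.comp hf)

theorem Primrec.transition_chan {f : α → CodedTransition} (hf : Primrec f) :
    Primrec fun a => (f a).chan := fst.comp (snd.comp (fst.comp (snd.comp hf)))

theorem Primrec.transition_msg {f : α → CodedTransition} (hf : Primrec f) :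
    Primrec fun a => (f a).msg := snd.comp (snd.comp (fst.comp (snd.comp hf)))

theorem Primrec.channelWord (ξ : Fin 2) : Primrec (channelWord ξ) := by
  refine Primrec.listFilterMap Primrec.id ?_
  exact Primrec.ite (PrimrecPred.eq_comp (transition_chan snd) (const ξ))
    (option_some.comp (transition_msg snd)) (const none)

theorem PrimrecPred.isPath {T ts : α → List CodedTransition} {p q : α → ℕ} (hT : Primrec T)
    (hp : Primrec p) (hts : Primrec ts) (hq : Primrec q) :
    PrimrecPred fun a => IsPath (T a) (p a) (ts a) (q a) := by
  refine PrimrecPred.and (.ball_list (.list_mem snd (hT.comp fst)) hts) ?_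
  exact .eq_comp (list_cons.comp hp (list_map hts (transition_dst snd)))
    (list_concat.comp (list_map hts (transition_src snd)) hq)

theorem PrimrecPred.isStabilityWitness {c : α → ProtocolCode 2 2} {s : α → Fin 2 → ℕ}
    {w : α → List CodedTransition × List CodedTransition} (hc : Primrec c) (hs : Primrec s)
    (hw : Primrec w) : PrimrecPred fun a => IsStabilityWitness (c a) (s a) (w a) := by
  have hs' (i : Fin 2) : Primrec fun a => s a i := fin_app.comp hs (const i)
  refine .and (.isPath ((protocolCode_trans 0).comp hc) ((protocolCode_home 0).comp hc)
    (fst.comp hw) (hs' 0)) (.and (.isPath ((protocolCode_trans 1).comp hc)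
    ((protocolCode_home 1).comp hc) (snd.comp hw) (hs' 1)) ?_)
  exact .forall_fin_two fun ξ =>
    .eq_comp ((Primrec.channelWord ξ).comp (fst.comp hw)) ((Primrec.channelWord ξ).comp (snd.comp hw))

theorem Primrec.classTable_size {D : α → ClassTable} (hD : Primrec D) :
    Primrec fun a => (D a).size := fst.comp hD

theorem Primrec.classTable_start {D : α → ClassTable} (hD : Primrec D) :
    Primrec fun a => (D a).start := fst.comp (snd.comp hD)

theorem Primrec.classTable_right {D : α → ClassTable} {f g : α → ℕ} (hD : Primrec D)
    (hf : Primrec f) (hg : Primrec g) : Primrec fun a => (D a).right (f a) (g a) :=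
  (list_getD 0).comp (fst.comp (snd.comp (snd.comp hD))) (Primrec₂.natPair.comp hf hg)

theorem Primrec.classTable_left {D : α → ClassTable} {f g : α → ℕ} (hD : Primrec D)
    (hf : Primrec f) (hg : Primrec g) : Primrec fun a => (D a).left (f a) (g a) :=
  (list_getD 0).comp (fst.comp (snd.comp (snd.comp (snd.comp hD)))) (Primrec₂.natPair.comp hf hg)

theorem Primrec.classTable_triples {D : α → ClassTable} (hD : Primrec D) :
    Primrec fun a => (D a).triples := snd.comp (snd.comp (snd.comp (snd.comp hD)))

theorem PrimrecPred.isCoherent {D : α → ClassTable} {T₀ T₁ : α → List CodedTransition}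
    (hD : Primrec D) (h₀ : Primrec T₀) (h₁ : Primrec T₁) :
    PrimrecPred fun a => (D a).IsCoherent (T₀ a) (T₁ a) := by
  refine .and (nat_lt.comp (classTable_start hD) (classTable_size hD)) (.and ?_ (.and ?_ ?_))
  · refine .ball_list (.ball_lt ?_ (classTable_size (hD.comp fst))) h₀
    have hD' := hD.comp (fst.comp (fst (α := α × CodedTransition) (β := ℕ)))
    exact nat_lt.comp (classTable_right hD' (transition_msg (snd.comp fst)) snd)
      (classTable_size hD')
  · refine .ball_list (.ball_list (.ball_lt ?_ (classTable_size (hD.comp (fst.comp fst))))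
      (h₁.comp fst)) h₀
    have hD' := hD.comp (fst.comp (fst.comp
      (fst (α := (α × CodedTransition) × CodedTransition) (β := ℕ))))
    have ht := transition_msg (snd.comp (fst.comp
      (fst (α := (α × CodedTransition) × CodedTransition) (β := ℕ))))
    have ht' := transition_msg (snd.comp
      (fst (α := (α × CodedTransition) × CodedTransition) (β := ℕ)))
    exact .eq_comp (classTable_left hD' ht' (classTable_right hD' ht snd))
      (classTable_right hD' ht (classTable_left hD' ht' snd))
  · refine .ball_list ?_ h₁
    have hD' := hD.comp (fst (α := α) (β := CodedTransition))
    exact .eq_comp (classTable_left hD' (transition_msg snd) (classTable_start hD'))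
      (classTable_right hD' (transition_msg snd) (classTable_start hD'))

theorem PrimrecPred.isClosed {D : α → ClassTable} {T₀ T₁ : α → List CodedTransition} (ξ : Fin 2)
    (hD : Primrec D) (h₀ : Primrec T₀) (h₁ : Primrec T₁) :
    PrimrecPred fun a => (D a).IsClosed ξ (T₀ a) (T₁ a) := by
  have hA := classTable_triples hD
  refine .and (.ball_list (.ball_list ?_ (h₀.comp fst)) hA)
    (.and (.ball_list (.ball_list ?_ (h₁.comp fst)) hA)
      (.ball_list (.ball_list (.ball_list ?_ (h₁.comp (fst.comp fst))) (h₀.comp fst)) hA))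
  · have he := snd.comp (fst (α := α × (ℕ × ℕ × ℕ)) (β := CodedTransition))
    have hD' := hD.comp (fst.comp (fst (α := α × (ℕ × ℕ × ℕ)) (β := CodedTransition)))
    refine .imp (.eq_comp (fst.comp he) (transition_src snd))
      (.imp (.eq_comp (transition_chan snd) (const ξ)) (.list_mem ?_ (classTable_triples hD')))
    exact (transition_dst snd).pair ((fst.comp (snd.comp he)).pair
      (classTable_right hD' (transition_msg snd) (snd.comp (snd.comp he))))
  · have he := snd.comp (fst (α := α × (ℕ × ℕ × ℕ)) (β := CodedTransition))
    have hD' := hD.comp (fst.comp (fst (α := α × (ℕ × ℕ × ℕ)) (β := CodedTransition)))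
    refine .imp (.eq_comp (fst.comp (snd.comp he)) (transition_src snd))
      (.imp (.eq_comp (transition_chan snd) (const ξ)) (.ball_lt ?_ (classTable_size hD')))
    have hD₂ := hD'.comp (fst (α := (α × (ℕ × ℕ × ℕ)) × CodedTransition) (β := ℕ))
    have he₂ := he.comp (fst (α := (α × (ℕ × ℕ × ℕ)) × CodedTransition) (β := ℕ))
    refine .imp (.eq_comp (classTable_left hD₂ (transition_msg (snd.comp fst)) snd)
      (snd.comp (snd.comp he₂))) (.list_mem ?_ (classTable_triples hD₂))
    exact (fst.comp he₂).pair ((transition_dst (snd.comp fst)).pair snd)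
  · have hf := fst (α := (α × (ℕ × ℕ × ℕ)) × CodedTransition) (β := CodedTransition)
    have he := snd.comp (fst.comp hf)
    have hD' := hD.comp (fst.comp (fst.comp hf))
    have ht := snd.comp hf
    refine .imp (.eq_comp (fst.comp he) (transition_src ht))
      (.imp (.eq_comp (fst.comp (snd.comp he)) (transition_src snd))
      (.imp (.eq_comp (transition_chan ht) (transition_chan snd))
      (.imp (.eq_comp (transition_msg ht) (transition_msg snd))
      (.imp (.not (.eq_comp (transition_chan ht) (const ξ)))
      (.list_mem ?_ (classTable_triples hD'))))))
    exact (transition_dst ht).pair ((transition_dst snd).pair (snd.comp (snd.comp he)))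

theorem PrimrecPred.isInstabilityCertificate {c : α → ProtocolCode 2 2} {s : α → Fin 2 → ℕ}
    {D : α → Fin 2 → ClassTable} (hc : Primrec c) (hs : Primrec s) (hD : Primrec D) :
    PrimrecPred fun a => IsInstabilityCertificate (c a) (s a) (D a) := by
  have hs' (i : Fin 2) : Primrec fun a => s a i := fin_app.comp hs (const i)
  have hD' (i : Fin 2) : Primrec fun a => D a i := fin_app.comp hD (const i)
  have hh (i : Fin 2) : Primrec fun a => (c a).home i := (protocolCode_home i).comp hc
  have ht (i : Fin 2) : Primrec fun a => (c a).trans i := (protocolCode_trans i).comp hc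
  refine .forall_fin_two fun ξ => .and (.isCoherent (hD' ξ) (ht 0) (ht 1))
    (.and (.isClosed ξ (hD' ξ) (ht 0) (ht 1)) (.and (.list_mem ((hh 0).pair ((hh 1).pair
      (classTable_start (hD' ξ)))) (classTable_triples (hD' ξ))) (.and ?_ (.not (.list_mem
      ((hs' 0).pair ((hs' 1).pair (classTable_start (hD' ξ)))) (classTable_triples (hD' ξ)))))))
  refine .forall_fin_two fun η => .ball_list ?_ (classTable_triples (hD' ξ))
  have hD₂ (i : Fin 2) := (hD' i).comp (fst (α := α) (β := ℕ × ℕ × ℕ))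
  exact .imp (.eq_comp (snd.comp (snd.comp snd)) (classTable_start (hD₂ ξ)))
    (.list_mem ((fst.comp snd).pair ((fst.comp (snd.comp snd)).pair (classTable_start (hD₂ η))))
      (classTable_triples (hD₂ η)))

end Primrec

/-! ### Parallel search for two kinds of witnesses -/

section searchVerdict

variable {X V W : Type*} [Primcodable V] [Primcodable W]

open Classical in
/-- Search for a witness of `p x`, which gives the answer `true`, or a witness of `q x`, which
gives the answer `false`. -/
noncomputable def searchVerdict (p : X → V → Prop) (q : X → W → Prop) (x : X) : Part Bool :=
  Nat.rfindOpt fun n => (Encodable.decode n : Option (V ⊕ W)).bind fun w =>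
    w.elim (fun v => if p x v then some true else none)
      (fun w => if q x w then some false else none)

theorem partrec_searchVerdict [Primcodable X] {p : X → V → Prop} {q : X → W → Prop} (hp : PrimrecRel p)
    (hq : PrimrecRel q) : Partrec (searchVerdict p q) := by
  classical
  refine Partrec.rfindOpt (Primrec.to_comp ?_ : Computable _)
  refine Primrec.option_bind (Primrec.decode.comp Primrec.snd) ?_
  have hx : Primrec fun y : ((X × ℕ) × (V ⊕ W)) => y.1.1 := Primrec.fst.comp Primrec.fst
  refine Primrec.of_eq (Primrec.sumCasesOn (f := fun y : ((X × ℕ) × (V ⊕ W)) => y.2)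
    (g := fun y v => if p y.1.1 v then some true else none)
    (h := fun y w => if q y.1.1 w then some false else none) Primrec.snd ?_ ?_) ?_
  · exact Primrec.ite (hp.comp (hx.comp Primrec.fst) Primrec.snd) (Primrec.const _)
      (Primrec.const _)
  · exact Primrec.ite (hq.comp (hx.comp Primrec.fst) Primrec.snd) (Primrec.const _)
      (Primrec.const _)
  · rintro ⟨⟨x, n⟩, v | w⟩ <;> rfl

theorem mem_searchVerdict {p : X → V → Prop} {q : X → W → Prop} {x : X} {b : Bool}
    (h : b ∈ searchVerdict p q x) : (b = true ∧ ∃ v, p x v) ∨ (b = false ∧ ∃ w, q x w) := by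
  obtain ⟨n, hn⟩ := Nat.rfindOpt_spec h
  obtain ⟨v | w, -, hw⟩ := Option.bind_eq_some_iff.1 hn
  · by_cases h : p x v
    · exact Or.inl ⟨by simpa [h] using hw.symm, _, h⟩
    · simp [h] at hw
  · by_cases h : q x w
    · exact Or.inr ⟨by simpa [h] using hw.symm, _, h⟩
    · simp [h] at hw

theorem searchVerdict_dom {p : X → V → Prop} {q : X → W → Prop} {x : X}
    (h : (∃ v, p x v) ∨ ∃ w, q x w) : (searchVerdict p q x).Dom := by
  rcases h with ⟨v, hv⟩ | ⟨w, hw⟩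
  · exact Nat.rfindOpt_dom.2
      ⟨Encodable.encode (Sum.inl v : V ⊕ W), true, by simp [-Encodable.encode_inl, hv]⟩
  · exact Nat.rfindOpt_dom.2
      ⟨Encodable.encode (Sum.inr w : V ⊕ W), false, by simp [-Encodable.encode_inr, hw]⟩

end searchVerdict

/-! ### Reachability in terms of codes -/

/-- The global states reachable in the protocol with code `c`, in terms of codes. -/
inductive CodedReach (c : ProtocolCode 2 2) : ℕ → ℕ → (Fin 2 → List ℕ) → Prop
  | home : CodedReach c (c.home 0) (c.home 1) fun _ => []
  | send {p₀ p₁ : ℕ} {x : Fin 2 → List ℕ} {t : CodedTransition} : CodedReach c p₀ p₁ x →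
      t ∈ c.trans 0 → t.src = p₀ →
      CodedReach c t.dst p₁ (Function.update x t.chan (x t.chan ++ [t.msg]))
  | recv {p₀ p₁ : ℕ} {x : Fin 2 → List ℕ} {t : CodedTransition} {y : List ℕ} :
      CodedReach c p₀ p₁ x → t ∈ c.trans 1 → t.src = p₁ → x t.chan = t.msg :: y →
      CodedReach c p₀ t.dst (Function.update x t.chan y)

namespace CFSMProtocol.Numbering

variable {P : CFSMProtocol.{u, v} parallelGraph} {c : ProtocolCode 2 2} (ν : P.Numbering c)

/-- The code of a message. -/
def msgCode (ξ : Fin 2) (b : P.Msg ξ) : ℕ := ν.msg ξ b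

/-- The codes of the words in the channels. -/
def contentCode (C : P.ChannelContent) (ξ : Fin 2) : List ℕ :=
  (C ξ).toList.map (ν.msgCode ξ)

theorem code_injective : Function.Injective ν.code := by
  intro S S' h
  funext j
  exact (ν.state j).injective (Fin.ext (congrFun h j))

theorem msgCode_injective (ξ : Fin 2) : Function.Injective (ν.msgCode ξ) := fun _ _ h =>
  (ν.msg ξ).injective (Fin.ext h)

theorem contentCode_injective : Function.Injective ν.contentCode := by
  intro C C' h
  funext ξ
  exact FreeMonoid.toList.injective
    (List.map_injective_iff.2 (ν.msgCode_injective ξ) (congrFun h ξ))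

theorem contentCode_one : ν.contentCode 1 = fun _ => [] := rfl

/-- No channel has head 0, so machine 0 only sends. This is why `CodedReach` may ignore the Boolean
tag of a transition. -/
theorem mem_trans_zero {t : CodedTransition} (ht : t ∈ c.trans 0) :
    ∃ p ξ h b q, (p, Letter.send ξ h b, q) ∈ P.trans 0 ∧
      t = ((ν.state 0 p : ℕ), (false, ξ, ν.msgCode ξ b), (ν.state 0 q : ℕ)) := by
  obtain ⟨p, l, q, h, rfl⟩ := (ν.mem_trans_iff 0 t).1 ht
  cases l with
  | recv ξ h' b => exact absurd h' (by simp [parallelGraph])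
  | send ξ h' b => exact ⟨p, ξ, h', b, q, h, rfl⟩

theorem mem_trans_one {t : CodedTransition} (ht : t ∈ c.trans 1) :
    ∃ p ξ h b q, (p, Letter.recv ξ h b, q) ∈ P.trans 1 ∧
      t = ((ν.state 1 p : ℕ), (true, ξ, ν.msgCode ξ b), (ν.state 1 q : ℕ)) := by
  obtain ⟨p, l, q, h, rfl⟩ := (ν.mem_trans_iff 1 t).1 ht
  cases l with
  | recv ξ h' b => exact ⟨p, ξ, h', b, q, h, rfl⟩
  | send ξ h' b => exact absurd h' (by simp [parallelGraph])

theorem exists_reachable_of_codedReach {p₀ p₁ : ℕ} {x : Fin 2 → List ℕ}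
    (h : CodedReach c p₀ p₁ x) : ∃ S C, P.Reachable (S, C) ∧ ν.code S 0 = p₀ ∧
      ν.code S 1 = p₁ ∧ ν.contentCode C = x := by
  induction h with
  | home => exact ⟨P.home, 1, .refl, ν.home_eq 0, ν.home_eq 1, rfl⟩
  | @send p₀ p₁ x t _ ht hsrc ih =>
    obtain ⟨S, C, hSC, rfl, rfl, rfl⟩ := ih
    obtain ⟨p, ξ, h, b, q, hl, rfl⟩ := ν.mem_trans_zero ht
    obtain rfl : p = S 0 := (ν.state 0).injective (Fin.ext hsrc)
    refine ⟨Function.update S 0 q, Function.update C ξ (C ξ * FreeMonoid.of b),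
      hSC.tail (.send _ _ _ _ 0 ξ h b (by simpa using hl) (fun i hi => by simp [hi]) (by simp)
        fun η hη => by simp [hη]), by simp [code], by simp [code], ?_⟩
    funext η
    by_cases hη : η = ξ
    · subst hη; simp [contentCode]
    · simp [contentCode, hη]
  | @recv p₀ p₁ x t y _ ht hsrc hx ih =>
    obtain ⟨S, C, hSC, rfl, rfl, rfl⟩ := ih
    obtain ⟨p, ξ, h, b, q, hl, rfl⟩ := ν.mem_trans_one ht
    obtain rfl : p = S 1 := (ν.state 1).injective (Fin.ext hsrc)
    have hx' : (C ξ).toList.map (ν.msgCode ξ) = ν.msgCode ξ b :: y := hx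
    clear hx
    obtain ⟨b', z, hC, hb, rfl⟩ := List.map_eq_cons_iff.1 hx'
    obtain rfl : b' = b := ν.msgCode_injective ξ hb
    refine ⟨Function.update S 1 q, Function.update C ξ (FreeMonoid.ofList z),
      hSC.tail (.recv _ _ _ _ 1 ξ h b' (by simpa using hl) (fun i hi => by simp [hi]) ?_
        fun η hη => by simp [hη]), by simp [code], by simp [code], ?_⟩
    · rw [Function.update_self]
      exact FreeMonoid.toList.injective hC
    · funext η
      by_cases hη : η = ξ
      · subst hη; simp [contentCode]
      · simp [contentCode, hη]

theorem contentCode_eq_update {C C' : P.ChannelContent} {ξ : Fin 2} {y : List ℕ}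
    (h : ν.contentCode C' ξ = y) (h' : ∀ η, η ≠ ξ → C' η = C η) :
    ν.contentCode C' = Function.update (ν.contentCode C) ξ y := by
  funext η
  by_cases hη : η = ξ
  · subst hη; simp [h]
  · simp [contentCode, hη, h' η hη]

theorem codedReach_of_reachable {X : P.GlobalState} (h : P.Reachable X) :
    CodedReach c (ν.code X.1 0) (ν.code X.1 1) (ν.contentCode X.2) := by
  induction h with
  | refl =>
    have h0 : ν.code P.home 0 = c.home 0 := ν.home_eq 0
    have h1 : ν.code P.home 1 = c.home 1 := ν.home_eq 1
    rw [ν.contentCode_one, h0, h1]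
    exact CodedReach.home
  | tail _ hstep ih =>
    cases hstep with
    | recv S S' C C' j ξ h b hl hS hC hC' =>
      obtain rfl : j = 1 := h.symm
      have ht := (ν.mem_trans_iff 1 _).2 ⟨_, _, _, hl, rfl⟩
      have hx : ν.contentCode C ξ = ν.msgCode ξ b :: ν.contentCode C' ξ := by
        simp [contentCode, hC]
      have hr := ih.recv ht rfl hx
      have h0 : ν.code S' 0 = ν.code S 0 := by simp [code, hS 0 (by simp)]
      rw [h0, ν.contentCode_eq_update (C := C) (C' := C') rfl hC']
      exact hr
    | send S S' C C' j ξ h b hl hS hC hC' =>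
      obtain rfl : j = 0 := h.symm
      have ht := (ν.mem_trans_iff 0 _).2 ⟨_, _, _, hl, rfl⟩
      have hr := ih.send ht rfl
      have h1 : ν.code S' 1 = ν.code S 1 := by simp [code, hS 1 (by simp)]
      rw [h1, ν.contentCode_eq_update (C := C) (C' := C')
        (y := ν.contentCode C ξ ++ [ν.msgCode ξ b]) (by simp [contentCode, hC]) hC']
      exact hr

theorem codedReach_iff {S : P.CompositeState} {C : P.ChannelContent} :
    CodedReach c (ν.code S 0) (ν.code S 1) (ν.contentCode C) ↔ P.Reachable (S, C) := by
  refine ⟨fun h => ?_, fun h => ν.codedReach_of_reachable h⟩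
  obtain ⟨S', C', h', h0, h1, hC⟩ := ν.exists_reachable_of_codedReach h
  obtain rfl : S' = S := ν.code_injective (funext (Fin.forall_fin_two.2 ⟨h0, h1⟩))
  obtain rfl : C' = C := ν.contentCode_injective hC
  exact h'

theorem stable_iff {S : P.CompositeState} :
    P.Stable S ↔ CodedReach c (ν.code S 0) (ν.code S 1) fun _ => [] := by
  rw [← ν.contentCode_one, codedReach_iff, Stable]

end CFSMProtocol.Numbering

/-! ### Regularity of the reachable contents on an axis -/

/-- The words `x` such that the state `(p₀, p₁)` is reachable with `x` on the channel `ξ` and the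
other channel empty. -/
def axisReach (c : ProtocolCode 2 2) (ξ : Fin 2) (p₀ p₁ : ℕ) : Language ℕ :=
  {x | CodedReach c p₀ p₁ (Function.update (fun _ => []) ξ x)}

theorem CFSMProtocol.Numbering.isRegular_axisReach {P : CFSMProtocol.{u, v} parallelGraph}
    {c : ProtocolCode 2 2} (ν : P.Numbering c) (hP : P.RationalChannelProperty) (ξ : Fin 2)
    (S : P.CompositeState) : (axisReach c ξ (ν.code S 0) (ν.code S 1)).IsRegular := by
  convert (hP S).isRegular_axisSection ν.msgCode ξ
  ext x
  constructor
  · intro h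
    obtain ⟨S', C, h', h0, h1, hC⟩ := ν.exists_reachable_of_codedReach h
    obtain rfl : S' = S := ν.code_injective (funext (Fin.forall_fin_two.2 ⟨h0, h1⟩))
    refine ⟨C, h', fun η hη => ?_, ?_⟩
    · have := congrFun hC η
      rw [Function.update_of_ne hη] at this
      exact List.map_eq_nil_iff.1 this
    · have := congrFun hC ξ
      rwa [Function.update_self] at this
  · rintro ⟨C, hC, h1, rfl⟩
    have := ν.codedReach_of_reachable hC
    rwa [ν.contentCode_eq_update (C := 1) rfl h1] at this

/-! ### Runs as pairs of paths -/

section Paths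

variable {T : List CodedTransition} {p q : ℕ} {t : CodedTransition} {ts : List CodedTransition}

theorem isPath_nil : IsPath T p [] q ↔ p = q := by
  simp [IsPath]

theorem isPath_cons :
    IsPath T p (t :: ts) q ↔ t ∈ T ∧ t.src = p ∧ IsPath T t.dst ts q := by
  simp only [IsPath, List.mem_cons, forall_eq_or_imp, List.map_cons, List.cons_append,
    List.cons.injEq]
  tauto

theorem IsPath.concat (h : IsPath T p ts q) (ht : t ∈ T) (hq : t.src = q) :
    IsPath T p (ts ++ [t]) t.dst := by
  induction ts generalizing p with
  | nil =>
    obtain rfl := isPath_nil.1 h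
    exact isPath_cons.2 ⟨ht, hq, isPath_nil.2 rfl⟩
  | cons t' ts ih =>
    obtain ⟨h1, h2, h3⟩ := isPath_cons.1 h
    exact isPath_cons.2 ⟨h1, h2, ih h3⟩

theorem channelWord_nil (ξ : Fin 2) : channelWord ξ [] = [] := rfl

theorem channelWord_cons_self : channelWord t.chan (t :: ts) = t.msg :: channelWord t.chan ts := by
  simp [channelWord]

theorem channelWord_cons_of_ne {ξ : Fin 2} (h : t.chan ≠ ξ) :
    channelWord ξ (t :: ts) = channelWord ξ ts := by
  simp [channelWord, h]

theorem channelWord_append (ξ : Fin 2) (ts ts' : List CodedTransition) :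
    channelWord ξ (ts ++ ts') = channelWord ξ ts ++ channelWord ξ ts' := by
  simp [channelWord]

theorem eq_nil_of_channelWord_eq_nil (h : ∀ ξ, channelWord ξ ts = []) : ts = [] := by
  cases ts with
  | nil => rfl
  | cons t ts => simpa [channelWord_cons_self] using h t.chan

end Paths

section Runs

variable {c : ProtocolCode 2 2} {p₀ p₁ q : ℕ}

theorem CodedReach.send_path {ts : List CodedTransition} {x : Fin 2 → List ℕ}
    (h : CodedReach c p₀ p₁ x) (hts : IsPath (c.trans 0) p₀ ts q) :
    CodedReach c q p₁ fun ξ => x ξ ++ channelWord ξ ts := by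
  induction ts generalizing p₀ x with
  | nil =>
    obtain rfl := isPath_nil.1 hts
    simpa [channelWord_nil] using h
  | cons t ts ih =>
    obtain ⟨h1, h2, h3⟩ := isPath_cons.1 hts
    convert ih (h.send h1 h2) h3 using 2 with ξ
    by_cases hξ : ξ = t.chan
    · subst hξ; simp [channelWord_cons_self]
    · simp [channelWord_cons_of_ne (Ne.symm hξ), hξ]

theorem CodedReach.recv_path {ts : List CodedTransition} {x : Fin 2 → List ℕ}
    (h : CodedReach c p₀ p₁ fun ξ => channelWord ξ ts ++ x ξ)
    (hts : IsPath (c.trans 1) p₁ ts q) : CodedReach c p₀ q x := by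
  induction ts generalizing p₁ with
  | nil =>
    obtain rfl := isPath_nil.1 hts
    exact h
  | cons t ts ih =>
    obtain ⟨h1, h2, h3⟩ := isPath_cons.1 hts
    refine ih ?_ h3
    convert h.recv h1 h2 (y := channelWord t.chan ts ++ x t.chan)
      (by simp [channelWord_cons_self]) using 2 with ξ
    by_cases hξ : ξ = t.chan
    · subst hξ; simp
    · simp [channelWord_cons_of_ne (Ne.symm hξ), hξ]

/-- A FIFO channel preserves order: what was sent is what was received followed by what remains. -/
theorem CodedReach.exists_paths {x : Fin 2 → List ℕ} (h : CodedReach c p₀ p₁ x) :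
    ∃ ts ts', IsPath (c.trans 0) (c.home 0) ts p₀ ∧ IsPath (c.trans 1) (c.home 1) ts' p₁ ∧
      ∀ ξ, channelWord ξ ts = channelWord ξ ts' ++ x ξ := by
  induction h with
  | home => exact ⟨[], [], isPath_nil.2 rfl, isPath_nil.2 rfl, fun _ => rfl⟩
  | @send p₀ p₁ x t _ ht hsrc ih =>
    obtain ⟨ts, ts', h1, h2, h3⟩ := ih
    refine ⟨ts ++ [t], ts', h1.concat ht hsrc, h2, fun ξ => ?_⟩
    rw [channelWord_append, h3]
    by_cases hξ : ξ = t.chan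
    · subst hξ; simp [channelWord_cons_self, channelWord_nil]
    · simp [channelWord_cons_of_ne (Ne.symm hξ), hξ, channelWord_nil]
  | @recv p₀ p₁ x t y _ ht hsrc hx ih =>
    obtain ⟨ts, ts', h1, h2, h3⟩ := ih
    refine ⟨ts, ts' ++ [t], h1, h2.concat ht hsrc, fun ξ => ?_⟩
    rw [channelWord_append, h3]
    by_cases hξ : ξ = t.chan
    · subst hξ; simp [channelWord_cons_self, channelWord_nil, hx]
    · simp [channelWord_cons_of_ne (Ne.symm hξ), hξ, channelWord_nil]

/-- For the existence of a run, the sender moves first along its whole path, and then the receiver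
empties the channels. -/
theorem exists_isStabilityWitness_iff {s : Fin 2 → ℕ} :
    (∃ w, IsStabilityWitness c s w) ↔ CodedReach c (s 0) (s 1) fun _ => [] := by
  constructor
  · rintro ⟨⟨ts, ts'⟩, h0, h1, h⟩
    refine CodedReach.recv_path (ts := ts') ?_ h1
    convert CodedReach.home.send_path h0 using 2 with ξ
    simp [h ξ]
  · intro h
    obtain ⟨ts, ts', h1, h2, h3⟩ := h.exists_paths
    exact ⟨(ts, ts'), h1, h2, by simpa using h3⟩

end Runs

/-! ### Soundness of instability certificates -/

namespace ClassTable

/-- The class of a word. -/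
def classOf (D : ClassTable) (x : List ℕ) : ℕ := x.foldl (fun m a => D.right a m) D.start

variable {D : ClassTable} {T₀ T₁ : List CodedTransition}

theorem classOf_concat (x : List ℕ) (a : ℕ) :
    D.classOf (x ++ [a]) = D.right a (D.classOf x) := by
  simp only [classOf, List.foldl_append, List.foldl_cons, List.foldl_nil]

theorem IsCoherent.classOf_lt (h : D.IsCoherent T₀ T₁) {x : List ℕ}
    (hx : ∀ a ∈ x, ∃ t ∈ T₀, t.msg = a) : D.classOf x < D.size := by
  induction x using List.reverseRecOn with
  | nil => exact h.1
  | append_singleton x a ih =>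
    obtain ⟨t, ht, rfl⟩ := hx a (by simp)
    rw [classOf_concat]
    exact h.2.1 t ht _ (ih fun b hb => hx b (by simp [hb]))

/-- Left and right multiplication agree on the empty class and commute, so prepending a letter can
be moved past every appended one. -/
theorem IsCoherent.left_classOf (h : D.IsCoherent T₀ T₁) {x : List ℕ}
    (hx : ∀ a ∈ x, ∃ t ∈ T₀, t.msg = a) {t' : CodedTransition} (ht' : t' ∈ T₁) :
    D.left t'.msg (D.classOf x) = D.classOf (t'.msg :: x) := by
  induction x using List.reverseRecOn with
  | nil => exact h.2.2.2 t' ht'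
  | append_singleton x a ih =>
    obtain ⟨t, ht, rfl⟩ := hx a (by simp)
    have hx' : ∀ b ∈ x, ∃ t ∈ T₀, t.msg = b := fun b hb => hx b (by simp [hb])
    rw [classOf_concat, h.2.2.1 t ht t' ht' _ (h.classOf_lt hx'), ih hx', ← List.cons_append,
      classOf_concat]

end ClassTable

/-- Invariant of the interleaving with one axis: `x` is the content of `ξ`, the other channel is
empty, and `ts`, `ts'` are the paths still to be run. Each move shortens them and stays inside the
triples, so the excluded target would be reached. -/
theorem IsInstabilityCertificate.not_paths {c : ProtocolCode 2 2} {s : Fin 2 → ℕ}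
    {D : Fin 2 → ClassTable} (hD : IsInstabilityCertificate c s D) (n : ℕ) :
    ∀ (ξ : Fin 2) (p₀ p₁ : ℕ) (x : List ℕ) (ts ts' : List CodedTransition),
      ts.length + ts'.length = n → IsPath (c.trans 0) p₀ ts (s 0) →
      IsPath (c.trans 1) p₁ ts' (s 1) → (∀ a ∈ x, ∃ t : CodedTransition, t ∈ c.trans 0 ∧ t.msg = a) →
      (p₀, p₁, (D ξ).classOf x) ∈ (D ξ).triples →
      ¬ ∀ η, Function.update (fun _ => []) ξ x η ++ channelWord η ts = channelWord η ts' := by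
  induction n using Nat.strong_induction_on with
  | _ n ih =>
    -- The receiver needs a message from the channel off the axis. This is proved for every axis at
    -- the same length `n`, because changing the axis consumes no transition and so cannot use the
    -- induction hypothesis.
    have other (ξ : Fin 2) (p₀ p₁ : ℕ) (x : List ℕ) (ts ts' : List CodedTransition)
        (t' : CodedTransition) (hn : ts.length + (t' :: ts').length = n)
        (hts : IsPath (c.trans 0) p₀ ts (s 0)) (hts' : IsPath (c.trans 1) p₁ (t' :: ts') (s 1))
        (hx : ∀ a ∈ x, ∃ t : CodedTransition, t ∈ c.trans 0 ∧ t.msg = a)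
        (hmem : (p₀, p₁, (D ξ).classOf x) ∈ (D ξ).triples) (hξ : t'.chan ≠ ξ)
        (h : ∀ η, Function.update (fun _ => []) ξ x η ++ channelWord η ts =
          channelWord η (t' :: ts')) : False := by
      obtain ⟨ht', hsrc', hp'⟩ := isPath_cons.1 hts'
      obtain ⟨-, ⟨hsend, -, hboth⟩, -⟩ := hD ξ
      have h1 := h t'.chan
      rw [Function.update_of_ne hξ, List.nil_append, channelWord_cons_self] at h1
      cases ts with
      | nil => simp [channelWord_nil] at h1
      | cons t ts =>
        obtain ⟨ht, hsrc, hp⟩ := isPath_cons.1 hts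
        by_cases htξ : t.chan = ξ
        · have hmem' := hsend _ hmem t ht hsrc.symm htξ
          rw [← ClassTable.classOf_concat] at hmem'
          refine ih _ ?_ ξ _ _ _ ts (t' :: ts') rfl hp hts' ?_ hmem' fun η => ?_
          · rw [← hn]; simp
          · intro a ha
            rcases List.mem_append.1 ha with ha | ha
            · exact hx a ha
            · exact ⟨t, ht, (List.mem_singleton.1 ha).symm⟩
          · rw [← h η]
            by_cases hη : η = ξ
            · subst hη; subst htξ; simp [channelWord_cons_self]
            · simp [hη, channelWord_cons_of_ne (htξ ▸ Ne.symm hη)]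
        -- Both channels differ from `ξ`, and there are only two.
        · have hch : t.chan = t'.chan := by omega
          rw [← hch, channelWord_cons_self, List.cons.injEq] at h1
          have hmem' := hboth _ hmem t ht t' ht' hsrc.symm hsrc'.symm hch h1.1 htξ
          refine ih _ ?_ ξ _ _ _ ts ts' rfl hp hp' hx hmem' fun η => ?_
          · rw [← hn]; simp only [List.length_cons]; omega
          · by_cases hη : η = t.chan
            · subst hη; simpa [htξ] using h1.2
            · have h2 := h η
              rwa [channelWord_cons_of_ne (Ne.symm hη),
                channelWord_cons_of_ne (hch ▸ Ne.symm hη)] at h2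
    intro ξ p₀ p₁ x ts ts' hn hts hts' hx hmem h
    obtain ⟨hcoh, ⟨-, hrecv, -⟩, -, hswitch, hfin⟩ := hD ξ
    cases ts' with
    | nil =>
      have h' (η) := List.append_eq_nil_iff.1 ((h η).trans (channelWord_nil η))
      obtain rfl := eq_nil_of_channelWord_eq_nil fun η => (h' η).2
      obtain rfl : x = [] := by simpa using (h' ξ).1
      rw [isPath_nil] at hts hts'
      subst hts hts'
      exact hfin hmem
    | cons t' ts' =>
      by_cases hξ : t'.chan = ξ
      · obtain ⟨ht', hsrc', hp'⟩ := isPath_cons.1 hts'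
        subst hξ
        cases x with
        | nil =>
          -- In `Fin 2`, `1 - ξ` is the other channel; it becomes the axis.
          have hne : t'.chan ≠ 1 - t'.chan := by omega
          refine other (1 - t'.chan) p₀ p₁ [] ts ts' t' hn hts hts' hx
            (hswitch (1 - t'.chan) _ hmem rfl) hne ?_
          simpa using h
        | cons a x =>
          have h1 := h t'.chan
          rw [Function.update_self, channelWord_cons_self, List.cons_append,
            List.cons.injEq] at h1
          obtain ⟨rfl, h1⟩ := h1
          have hx' : ∀ a ∈ x, ∃ t : CodedTransition, t ∈ c.trans 0 ∧ t.msg = a := fun a ha =>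
            hx a (List.mem_cons_of_mem _ ha)
          have hmem' := hrecv _ hmem t' ht' hsrc'.symm rfl _ (hcoh.classOf_lt hx')
            (hcoh.left_classOf hx' ht')
          refine ih _ ?_ _ _ _ x ts ts' rfl hts hp' hx' hmem' fun η => ?_
          · rw [← hn]; simp
          · by_cases hη : η = t'.chan
            · subst hη; simpa using h1
            · have h2 := h η
              rw [channelWord_cons_of_ne (Ne.symm hη)] at h2
              simpa [hη] using h2
      · exact other ξ p₀ p₁ x ts ts' t' hn hts hts' hx hmem hξ h

theorem IsInstabilityCertificate.not_codedReach {c : ProtocolCode 2 2} {s : Fin 2 → ℕ}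
    {D : Fin 2 → ClassTable} (hD : IsInstabilityCertificate c s D) :
    ¬ CodedReach c (s 0) (s 1) fun _ => [] := by
  intro h
  obtain ⟨ts, ts', h1, h2, h3⟩ := h.exists_paths
  exact hD.not_paths _ 0 _ _ [] ts ts' rfl h1 h2 (by simp) (hD 0).2.2.1 (by simpa using h3)

/-! ### Existence of instability certificates -/

theorem exists_list_getD_natPair (f : ℕ → ℕ → ℕ) (N : ℕ) :
    ∃ l : List ℕ, ∀ a < N, ∀ m < N, l.getD (Nat.pair a m) 0 = f a m := by
  refine ⟨(List.range (N ^ 2)).map fun n => f n.unpair.1 n.unpair.2, fun a ha m hm => ?_⟩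
  have h : Nat.pair a m < N ^ 2 :=
    (Nat.pair_lt_max_add_one_sq a m).trans_le (Nat.pow_le_pow_left (by omega) 2)
  simp [h]

theorem exists_fun_of_fiberwise {α : Type*} (ψ : List α → ℕ) (F : α → List α → ℕ)
    (hF : ∀ x y, ψ x = ψ y → ∀ a, F a x = F a y) :
    ∃ f : α → ℕ → ℕ, ∀ a x, f a (ψ x) = F a x := by
  classical
  refine ⟨fun a m => if h : ∃ x, ψ x = m then F a h.choose else 0, fun a x => ?_⟩
  have h : ∃ y, ψ y = ψ x := ⟨x, rfl⟩
  refine (dif_pos h).trans ?_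
  exact hF _ _ h.choose_spec a

/-- The table records the multiplication of a congruence that saturates the axis languages of all
composite states at once, together with the classes that are really reached. -/
theorem CFSMProtocol.Numbering.exists_classTable {P : CFSMProtocol.{u, v} parallelGraph}
    {c : ProtocolCode 2 2} (ν : P.Numbering c) (hP : P.RationalChannelProperty) (ξ : Fin 2) :
    ∃ (D : ClassTable) (ψ : List ℕ → ℕ), D.start = ψ [] ∧ (∀ m, m < D.size ↔ ∃ x, ψ x = m) ∧
      (∀ t : CodedTransition, t ∈ c.trans 0 ++ c.trans 1 → ∀ x, D.right t.msg (ψ x) = ψ (x ++ [t.msg]) ∧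
        D.left t.msg (ψ x) = ψ (t.msg :: x)) ∧
      (∀ p₀ p₁ m, (p₀, p₁, m) ∈ D.triples ↔ ∃ x ∈ axisReach c ξ p₀ p₁, ψ x = m) ∧
      ∀ x y, ψ x = ψ y → ∀ p₀ p₁, x ∈ axisReach c ξ p₀ p₁ → y ∈ axisReach c ξ p₀ p₁ := by
  have hfs : ∀ j, Finite (P.State j) := P.finite_state
  obtain ⟨k, ψ, hk, hψ⟩ := Language.exists_congruence_numbering
    (fun S : P.CompositeState => axisReach c ξ (ν.code S 0) (ν.code S 1))
    fun S => ν.isRegular_axisReach hP ξ S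
  -- Pairs of numbers that code no composite state have an empty axis language, so saturation
  -- extends to all pairs.
  have hcode (p₀ p₁ x) (hx : x ∈ axisReach c ξ p₀ p₁) :
      ∃ S, ν.code S 0 = p₀ ∧ ν.code S 1 = p₁ := by
    obtain ⟨S, -, -, h0, h1, -⟩ := ν.exists_reachable_of_codedReach hx
    exact ⟨S, h0, h1⟩
  obtain ⟨M, hM⟩ : ∃ M, ∀ t : CodedTransition, t ∈ c.trans 0 ++ c.trans 1 → t.msg < M := by
    obtain ⟨M, hM⟩ := (((c.trans 0 ++ c.trans 1).map CodedTransition.msg).finite_toSet).bddAbove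
    exact ⟨M + 1, fun t ht => Nat.lt_succ_of_le (hM (List.mem_map.2 ⟨t, ht, rfl⟩))⟩
  obtain ⟨r, hr⟩ := exists_fun_of_fiberwise ψ (fun a x => ψ (x ++ [a]))
    fun x y h => (hψ x y h).2.1
  obtain ⟨l, hl⟩ := exists_fun_of_fiberwise ψ (fun a x => ψ (a :: x)) fun x y h => (hψ x y h).1
  obtain ⟨R, hR⟩ := exists_list_getD_natPair r (max M k)
  obtain ⟨L, hL⟩ := exists_list_getD_natPair l (max M k)
  have hfin : {e : ℕ × ℕ × ℕ | ∃ x ∈ axisReach c ξ e.1 e.2.1, ψ x = e.2.2}.Finite := by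
    refine ((Set.finite_univ (α := P.CompositeState)).prod (Set.finite_Iio k)).image
      (fun y => (ν.code y.1 0, ν.code y.1 1, y.2)) |>.subset ?_
    rintro ⟨p₀, p₁, m⟩ ⟨x, hx, hm⟩
    obtain ⟨S, rfl, rfl⟩ := hcode _ _ x hx
    exact ⟨(S, m), ⟨trivial, (hk m).2 ⟨x, hm⟩⟩, rfl⟩
  refine ⟨(k, ψ [], R, L, hfin.toFinset.toList), ψ, rfl, hk, fun t ht x => ⟨?_, ?_⟩,
    fun p₀ p₁ m => by simp [ClassTable.triples], fun x y h p₀ p₁ hx => ?_⟩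
  · rw [← hr]
    exact hR _ (lt_max_of_lt_left (hM t ht)) _ (lt_max_of_lt_right ((hk _).2 ⟨x, rfl⟩))
  · rw [← hl]
    exact hL _ (lt_max_of_lt_left (hM t ht)) _ (lt_max_of_lt_right ((hk _).2 ⟨x, rfl⟩))
  · obtain ⟨S, rfl, rfl⟩ := hcode _ _ x hx
    exact ((hψ x y h).2.2 S).1 hx

theorem CFSMProtocol.Numbering.exists_isInstabilityCertificate
    {P : CFSMProtocol.{u, v} parallelGraph} {c : ProtocolCode 2 2} (ν : P.Numbering c)
    (hP : P.RationalChannelProperty) {s : Fin 2 → ℕ}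
    (hs : ¬ CodedReach c (s 0) (s 1) fun _ => []) : ∃ D, IsInstabilityCertificate c s D := by
  choose D ψ hstart hsize hact hmem hsat using ν.exists_classTable hP
  have hact₀ (ξ) {t} (ht : t ∈ c.trans 0) := hact ξ t (List.mem_append_left _ ht)
  have hact₁ (ξ) {t} (ht : t ∈ c.trans 1) := hact ξ t (List.mem_append_right _ ht)
  have hempty (ξ p₀ p₁) : [] ∈ axisReach c ξ p₀ p₁ ↔ CodedReach c p₀ p₁ fun _ => [] := by
    have h : Function.update (fun _ : Fin 2 => ([] : List ℕ)) ξ [] = fun _ => [] :=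
      Function.update_eq_self ξ _
    change CodedReach c p₀ p₁ _ ↔ _
    rw [h]
  refine ⟨D, fun ξ => ⟨⟨?_, ?_, ?_, ?_⟩, ⟨?_, ?_, ?_⟩, ?_, ?_, ?_⟩⟩
  · exact (hsize ξ _).2 ⟨[], (hstart ξ).symm⟩
  · intro t ht m hm
    obtain ⟨x, rfl⟩ := (hsize ξ m).1 hm
    rw [((hact₀ ξ ht) x).1]
    exact (hsize ξ _).2 ⟨_, rfl⟩
  · intro t ht t' ht' m hm
    obtain ⟨x, rfl⟩ := (hsize ξ m).1 hm
    rw [(hact₀ ξ ht x).1, (hact₁ ξ ht' x).2, (hact₁ ξ ht' _).2, (hact₀ ξ ht _).1,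
      List.cons_append]
  · intro t' ht'
    rw [hstart, (hact₁ ξ ht' []).1, (hact₁ ξ ht' []).2, List.nil_append]
  · rintro ⟨p₀, p₁, m⟩ he t ht hsrc rfl
    obtain ⟨x, hx, rfl⟩ := (hmem _ _ _ _).1 he
    refine (hmem _ _ _ _).2 ⟨x ++ [t.msg], ?_, ((hact₀ _ ht x).1).symm⟩
    have := CodedReach.send hx ht hsrc.symm
    rwa [Function.update_idem, Function.update_self] at this
  · rintro ⟨p₀, p₁, m'⟩ he t' ht' hsrc rfl m hm hlm
    obtain ⟨x, rfl⟩ := (hsize _ m).1 hm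
    obtain ⟨y, hy, rfl⟩ := (hmem _ _ _ _).1 he
    rw [(hact₁ _ ht' x).2] at hlm
    refine (hmem _ _ _ _).2 ⟨x, ?_, rfl⟩
    -- The class of `t'.msg :: x` is reached through some `y`; saturation makes `t'.msg :: x` itself
    -- reachable, so its first letter can be received.
    have hy' : CodedReach c p₀ p₁ _ := hsat _ _ _ hlm.symm _ _ hy
    have := hy'.recv ht' hsrc.symm (y := x) (by simp)
    rwa [Function.update_idem] at this
  · rintro ⟨p₀, p₁, m⟩ he t ht t' ht' hsrc hsrc' hch hmsg hξ
    obtain ⟨x, hx, rfl⟩ := (hmem _ _ _ _).1 he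
    refine (hmem _ _ _ _).2 ⟨x, ?_, rfl⟩
    have h1 := (CodedReach.send hx ht hsrc.symm).recv ht' hsrc'.symm (y := [])
      (by simp [← hch, hξ, hmsg])
    rw [← hch, Function.update_idem] at h1
    have h2 : Function.update (Function.update (fun _ : Fin 2 => ([] : List ℕ)) ξ x) t.chan [] =
        Function.update (fun _ => []) ξ x := by
      rw [Function.update_eq_self_iff, Function.update_of_ne hξ]
    rw [h2] at h1
    exact h1
  · rw [hmem, hstart]
    exact ⟨[], (hempty _ _ _).2 .home, rfl⟩
  · rintro η ⟨p₀, p₁, m⟩ he hm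
    obtain ⟨x, hx, rfl⟩ := (hmem _ _ _ _).1 he
    have h := hsat ξ x [] (hm.trans (hstart ξ)) _ _ hx
    rw [hmem, hstart]
    exact ⟨[], (hempty _ _ _).2 ((hempty _ _ _).1 h), rfl⟩
  · rw [hmem, hstart]
    rintro ⟨x, hx, h⟩
    exact hs ((hempty _ _ _).1 (hsat ξ x [] h _ _ hx))

/-! ### The decision procedure -/

/-- A single algorithm `f` (a partial recursive function) that, given the code of any protocol on
the graph with two parallel channels `0 → 1` that has the rational channel property, together
with the code of any composite state of it, halts and answers whether that state is stable. -/
theorem theorem10p3 :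
    ∃ f : ProtocolCode 2 2 × (Fin 2 → ℕ) →. Bool, Partrec f ∧
      ∀ P : CFSMProtocol.{u, v} parallelGraph, P.RationalChannelProperty →
        ∀ (c : ProtocolCode 2 2) (ν : P.Numbering c) (S : P.CompositeState),
          ∃ b ∈ f (c, ν.code S), (b = true ↔ P.Stable S) := by
  refine ⟨searchVerdict (fun x w => IsStabilityWitness x.1 x.2 w)
    (fun x D => IsInstabilityCertificate x.1 x.2 D), partrec_searchVerdict ?_ ?_, ?_⟩
  · exact PrimrecPred.primrecRel (PrimrecPred.isStabilityWitness
      (Primrec.fst.comp Primrec.fst) (Primrec.snd.comp Primrec.fst) Primrec.snd)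
  · exact PrimrecPred.primrecRel (PrimrecPred.isInstabilityCertificate
      (Primrec.fst.comp Primrec.fst) (Primrec.snd.comp Primrec.fst) Primrec.snd)
  · intro P hP c ν S
    -- Rationality serves only to make the search halt; both kinds of witness are sound without it.
    have hdom := searchVerdict_dom (p := fun x w => IsStabilityWitness x.1 x.2 w)
      (q := fun x D => IsInstabilityCertificate x.1 x.2 D) (x := (c, ν.code S)) (by
        by_cases h : CodedReach c (ν.code S 0) (ν.code S 1) fun _ => []
        · exact Or.inl (exists_isStabilityWitness_iff.2 h)
        · exact Or.inr (ν.exists_isInstabilityCertificate hP h))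
    refine ⟨_, Part.get_mem hdom, ?_⟩
    rw [ν.stable_iff]
    rcases mem_searchVerdict (Part.get_mem hdom) with ⟨hb, h⟩ | ⟨hb, D, hD⟩
    · simp only [hb, true_iff]
      exact exists_isStabilityWitness_iff.1 h
    · simp only [hb, Bool.false_eq_true, false_iff]
      exact hD.not_codedReach
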